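/- \textbf{Conventions.} Let $F$ be a field. The algebraic cube is $\square_F=\mathbb{P}^1_F\setminus\{1\}\cong\mathbb{A}^1_F$ with standard coordinate $z$, and $\square_F^n=(\square_F)^n$; its faces are the closed subsets $\{z_i=\varepsilon_i \text{ for all } i\in I\}$ with $I\subseteq\{1,\dots,n\}$ and $\varepsilon_i\in\{0,\infty\}$. A closed irreducible subvariety $Z\subseteq\square_F^n$ of codimension $p$ is called \emph{admissible} if for every face $D$ each irreducible component of $Z\cap D$ has codimension $p$ in $D$ (in particular $Z\cap D$ may be empty). The group $\mathcal{Z}^p(F,n)$ is the group of coinvariants of $S_n\ltimes(\mathbb{Z}/2)^n$, acting by permuting and inverting the coordinates and twisted by its sign character, on the free abelian group on the admissible closed irreducible subvarieties of codimension $p$ in $\square_F^n$; the group of all (not necessarily admissible) cubical cycles on $\square_F^n$ is defined in the same way from all closed irreducible subvarieties. An $F^\times$-decorated tree $T$ is a finite tree in which every vertex has valency $1$ (external vertices) or $\geq 3$ (internal vertices), with a cyclic ordering of the incident edges at each vertex, a distinguished external vertex (the root), and a map from the external vertices (the root included) to $F^\times$. It is \emph{generic} if this map is injective. The leaves are the external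 vertices other than the root. Put $y_v\in F^\times$ equal to the decoration of $v$ if $v$ is external, and let the $y_v$, $v$ internal, be independent variables. Direct all edges away from the root and attach to an edge $e$ from $v$ to $w$ the coordinate $z_e=1-y_v/y_w$. For an ordering $e_1,\dots,e_n$ of the set of edges of $T$, let $Z(T;e_1,\dots,e_n)\subseteq\square_F^n$ be the closed irreducible subvariety parametrized by $(z_{e_1},\dots,z_{e_n})$, i.e. the closure of the image of the generic point of the parameter space. Permuting the edges permutes the coordinates, so if $\omega$ is an orientation of $T$ (an ordering of its edges up to even permutations), the class $\varphi(T,\omega)$ of $Z(T;e_1,\dots,e_n)$ in the group of all cubical cycles on $\square_F^n$, for any ordering that represents $\omega$, is well defined. The map $\varphi$ is the forest cycling map on trees. \textbf{Lemma (Each generic $F^\times$-deco tree maps to an admissible cycle).} Let $T$ be a generic $F^\times$-decorated tree with $n$ edges and $p$ leaves. Then for every ordering $e_1,\dots,e_n$ of its edges the subvariety $Z(T;e_1,\dots,e_n)$ of $\square_F^n$ has codimension $p$ and is admissible: it meets every face of $\square_F^n$ in codimension $p$ or not at all. Consequently, for every orientation $\omega$ of $T$, the cycle $\varphi(T,\omega)$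 comes from $\mathcal{Z}^p(F,n)$. -/

import Mathlib

noncomputable section

namespace CubicalCycles

/-! ### The algebraic cube

`□_F = ℙ¹_F ∖ {1}`, with standard coordinate `z`, is the affine line with coordinate
`s = z / (z - 1)`; under this isomorphism `z = 0` becomes `s = 0` and `z = ∞` becomes `s = 1`. -/

open Classical in
/-- The isomorphism `ℙ¹ ∖ {1} ≃ 𝔸¹`, `z ↦ z / (z - 1)`, on `K`-points, where `ℙ¹(K) = K ∪ {∞}`. -/
def cubeCoord (K : Type*) [Field K] : {z : OnePoint K // z ≠ ((1 : K) : OnePoint K)} ≃ K where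
  toFun z := z.1.elim 1 (fun a : K => a / (a - 1))
  invFun s :=
    if h : s = 1 then ⟨OnePoint.infty, OnePoint.infty_ne_coe 1⟩
    else ⟨((s / (s - 1) : K) : OnePoint K), by
      intro H
      have h1 : s - 1 ≠ 0 := sub_ne_zero.mpr h
      have H' := OnePoint.coe_injective H
      rw [div_eq_one_iff_eq h1] at H'
      exact one_ne_zero (sub_eq_self.mp H'.symm)⟩
  left_inv := by
    rintro ⟨z, hz⟩
    induction z using OnePoint.rec with
    | infty => simp
    | coe a =>
      have ha : a - 1 ≠ 0 := by
        intro h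
        exact hz (by rw [sub_eq_zero.mp h])
      have hne : a / (a - 1) ≠ 1 := by
        intro H
        rw [div_eq_one_iff_eq ha] at H
        exact one_ne_zero (sub_eq_self.mp H.symm)
      have hs : a / (a - 1) - 1 = 1 / (a - 1) := by
        field_simp
        ring
      simp only [hne, dite_false, Subtype.mk.injEq, OnePoint.coe_eq_coe, OnePoint.elim_some, hs]
      field_simp
  right_inv := by
    intro s
    by_cases h : s = 1
    · simp [h]
    · have h1 : s - 1 ≠ 0 := sub_ne_zero.mpr h
      have hs : s / (s - 1) - 1 = 1 / (s - 1) := by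
        field_simp
        ring
      simp only [h, dite_false, OnePoint.elim_some, hs]
      field_simp

/-- The algebraic cube `□_F^n = Spec F[s_1, …, s_n]`, with `s_i = z_i / (z_i - 1)`. -/
abbrev Cube (F : Type*) [Field F] (n : ℕ) : Type _ := PrimeSpectrum (MvPolynomial (Fin n) F)

/-- The point of `□_F^n` underlying a `K`-valued point `(z_1, …, z_n)`, `z_i ∈ ℙ¹(K) ∖ {1}`,
for a field extension `K` of `F`: the kernel of evaluation at that point. -/
def cubePoint (F : Type*) [Field F] {K : Type*} [Field K] [Algebra F K] {n : ℕ}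
    (z : Fin n → {z : OnePoint K // z ≠ ((1 : K) : OnePoint K)}) : Cube F n :=
  ⟨RingHom.ker (MvPolynomial.aeval (fun i => cubeCoord K (z i)) : MvPolynomial (Fin n) F →ₐ[F] K),
    RingHom.ker_isPrime _⟩

/-- The two endpoints of the cube `□_F`. -/
inductive Endpoint
  | zero
  | infty

/-- The endpoints as `F`-points of `ℙ¹ ∖ {1}`. -/
def Endpoint.toPoint (F : Type*) [Field F] :
    Endpoint → {z : OnePoint F // z ≠ ((1 : F) : OnePoint F)}
  | .zero => ⟨((0 : F) : OnePoint F), fun h => zero_ne_one (OnePoint.coe_injective h)⟩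
  | .infty => ⟨OnePoint.infty, OnePoint.infty_ne_coe 1⟩

/-- The face `{z_i = ε_i for all i ∈ I}` of `□_F^n`, where `ε_i ∈ {0, ∞}`. -/
def face {F : Type*} [Field F] {n : ℕ} (I : Finset (Fin n)) (ε : Fin n → Endpoint) :
    Set (Cube F n) :=
  PrimeSpectrum.zeroLocus
    {f | ∃ i ∈ I, f = MvPolynomial.X i - MvPolynomial.C (cubeCoord F ((ε i).toPoint F))}

/-! ### Codimension, proper intersection, admissibility -/

/-- The codimension of an irreducible closed subset `Y` in a subset `D` that contains it: the
supremum of the lengths `k` of chains `Y = Y_0 ⊊ Y_1 ⊊ ⋯ ⊊ Y_k ⊆ D` of irreducible closed subsets. -/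
def codimIn {X : Type*} [TopologicalSpace X] (D : Set X)
    (Y : TopologicalSpace.IrreducibleCloseds X) (h : (Y : Set X) ⊆ D) : ℕ∞ :=
  Order.coheight
    (⟨Y, h⟩ : {W : TopologicalSpace.IrreducibleCloseds X // (W : Set X) ⊆ D})

/-- `Z` meets `D` in codimension `p` or not at all: every irreducible component of `Z ∩ D` has
codimension `p` in `D` (there are no components if `Z ∩ D` is empty). -/
def MeetsInCodim {X : Type*} [TopologicalSpace X] (p : ℕ) (Z D : Set X) : Prop :=
  ∀ (Y : TopologicalSpace.IrreducibleCloseds X)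
    (hY : Maximal (fun W : TopologicalSpace.IrreducibleCloseds X => (W : Set X) ⊆ Z ∩ D) Y),
    codimIn D Y (hY.prop.trans Set.inter_subset_right) = p

/-- A closed irreducible subvariety `Z` of `□_F^n` of codimension `p` is admissible if it meets
every face in codimension `p` or not at all. -/
structure IsAdmissible {F : Type*} [Field F] {n : ℕ} (p : ℕ)
    (Z : TopologicalSpace.IrreducibleCloseds (Cube F n)) : Prop where
  codim_eq : codimIn Set.univ Z (Set.subset_univ _) = p
  proper : ∀ (I : Finset (Fin n)) (ε : Fin n → Endpoint),
    MeetsInCodim p (Z : Set (Cube F n)) (face I ε)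

/-! ### Alternating cycle groups -/

/-- The element of `S_n ⋉ (ℤ/2)^n` given by `σ` and `η`, acting on coordinate functions:
`z_i ↦ z_{σ i}`, or `z_i ↦ z_{σ i}⁻¹` if `η i` holds. In the coordinate `s = z / (z - 1)`, the
inversion `z ↦ z⁻¹` is `s ↦ 1 - s`. -/
def cubeActHom (F : Type*) [Field F] {n : ℕ} (σ : Equiv.Perm (Fin n)) (η : Fin n → Bool) :
    MvPolynomial (Fin n) F →ₐ[F] MvPolynomial (Fin n) F :=
  MvPolynomial.aeval fun i =>
    if η i then 1 - MvPolynomial.X (σ i) else MvPolynomial.X (σ i)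

/-- The automorphism of `□_F^n` that permutes the coordinates by `σ` and inverts those selected
by `η`. -/
def cubeAct (F : Type*) [Field F] {n : ℕ} (σ : Equiv.Perm (Fin n)) (η : Fin n → Bool) :
    Cube F n → Cube F n :=
  PrimeSpectrum.comap (cubeActHom F σ η).toRingHom

/-- The sign character `ε_n` of `S_n ⋉ (ℤ/2)^n`. -/
def cubeSign {n : ℕ} (σ : Equiv.Perm (Fin n)) (η : Fin n → Bool) : ℤ :=
  (Equiv.Perm.sign σ : ℤ) * ∏ i, (if η i then (-1 : ℤ) else 1)

/-- The relations `[g Z] = ε_n(g) [Z]`, for `Z` and `g Z` in `S`. -/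
def alternatingRelations {F : Type*} [Field F] {n : ℕ}
    (S : Set (TopologicalSpace.IrreducibleCloseds (Cube F n))) : AddSubgroup (FreeAbelianGroup S) :=
  AddSubgroup.closure
    {c | ∃ (Z W : S) (σ : Equiv.Perm (Fin n)) (η : Fin n → Bool),
      ((W : TopologicalSpace.IrreducibleCloseds (Cube F n)) : Set (Cube F n)) =
        cubeAct F σ η '' ((Z : TopologicalSpace.IrreducibleCloseds (Cube F n)) : Set (Cube F n)) ∧
      c = FreeAbelianGroup.of W - cubeSign σ η • FreeAbelianGroup.of Z}

/-- For a set `S` of closed irreducible subvarieties of `□_F^n` that is stable under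
`S_n ⋉ (ℤ/2)^n`: the coinvariants of `ℤ[S] ⊗ ε_n`. -/
abbrev AltCycles {F : Type*} [Field F] {n : ℕ}
    (S : Set (TopologicalSpace.IrreducibleCloseds (Cube F n))) : Type _ :=
  FreeAbelianGroup S ⧸ alternatingRelations S

/-- The group of all cubical algebraic cycles on `□_F^n`, admissible or not. -/
abbrev AllCycles (F : Type*) [Field F] (n : ℕ) : Type _ :=
  AltCycles (Set.univ : Set (TopologicalSpace.IrreducibleCloseds (Cube F n)))

/-- The group `𝒵^p(F, n)` of admissible cubical algebraic cycles. -/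
abbrev AdmissibleCycles (F : Type*) [Field F] (p n : ℕ) : Type _ :=
  AltCycles {Z : TopologicalSpace.IrreducibleCloseds (Cube F n) | IsAdmissible p Z}

/-- The class of a closed irreducible subvariety in `AltCycles S`. -/
def cycleClass {F : Type*} [Field F] {n : ℕ}
    {S : Set (TopologicalSpace.IrreducibleCloseds (Cube F n))} (Z : S) : AltCycles S :=
  QuotientAddGroup.mk (FreeAbelianGroup.of Z)

theorem cycleClass_eq_of_act {F : Type*} [Field F] {n : ℕ}
    {S : Set (TopologicalSpace.IrreducibleCloseds (Cube F n))} {Z W : S}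
    (σ : Equiv.Perm (Fin n)) (η : Fin n → Bool)
    (h : ((W : TopologicalSpace.IrreducibleCloseds (Cube F n)) : Set (Cube F n)) =
      cubeAct F σ η '' ((Z : TopologicalSpace.IrreducibleCloseds (Cube F n)) : Set (Cube F n))) :
    cycleClass W = cubeSign σ η • cycleClass Z := by
  have hmem : FreeAbelianGroup.of W - cubeSign σ η • FreeAbelianGroup.of Z ∈
      alternatingRelations S := AddSubgroup.subset_closure ⟨Z, W, σ, η, h, rfl⟩
  have h0 := (QuotientAddGroup.eq_zero_iff _).mpr hmem
  rw [QuotientAddGroup.mk_sub, QuotientAddGroup.mk_zsmul, sub_eq_zero] at h0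
  exact h0

/-- The natural map from `𝒵^p(F, n)` to the group of all cubical cycles. -/
def admissibleToAll (F : Type*) [Field F] (p n : ℕ) : AdmissibleCycles F p n →+ AllCycles F n :=
  QuotientAddGroup.lift _ (FreeAbelianGroup.lift fun Z => cycleClass ⟨Z.1, Set.mem_univ _⟩) (by
    rw [alternatingRelations, AddSubgroup.closure_le]
    rintro _ ⟨Z, W, σ, η, h, rfl⟩
    have key := cycleClass_eq_of_act (S := Set.univ) (Z := ⟨Z.1, Set.mem_univ _⟩)
      (W := ⟨W.1, Set.mem_univ _⟩) σ η h
    simp [key])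

/-! ### Decorated trees -/

/-- A planted plane tree with vertex set `V` and a decoration of its external vertices by `R`:
a finite tree, all of whose vertices have valency `1` (external vertices) or at least `3`
(internal vertices), with a cyclic ordering of the edges at every vertex and a distinguished
external vertex. -/
structure DecoTree (V : Type*) [Finite V] (R : Type*) where
  graph : SimpleGraph V
  isTree : graph.IsTree
  /-- The edges at `v` are listed by the neighbours of `v`; the permutation sends each to the next
  one in the cyclic ordering. -/
  next : ∀ v, Equiv.Perm (graph.neighborSet v)
  next_isCycleOn : ∀ v, (next v).IsCycleOn Set.univ
  valency : ∀ v, (graph.neighborSet v).ncard = 1 ∨ 3 ≤ (graph.neighborSet v).ncard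
  root : V
  root_external : (graph.neighborSet root).ncard = 1
  deco : {v : V // (graph.neighborSet v).ncard = 1} → R

namespace DecoTree

variable {V : Type*} [Finite V] {R : Type*}

/-- External vertices are those of valency `1`. -/
def IsExternal (T : DecoTree V R) (v : V) : Prop := (T.graph.neighborSet v).ncard = 1

/-- A decorated tree is generic if its decorations (the one of the root included) are pairwise
different. -/
def IsGeneric (T : DecoTree V R) : Prop := Function.Injective T.deco

/-- The number of leaves, i.e. of external vertices other than the root. -/
def numLeaves (T : DecoTree V R) : ℕ := {v : V | T.IsExternal v ∧ v ≠ T.root}.ncard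

/-- The edges of the tree, each with its direction away from the root. -/
def Edge (T : DecoTree V R) : Type _ :=
  {d : T.graph.Dart // T.graph.dist T.root d.fst < T.graph.dist T.root d.snd}

/-- The vertex of an edge that is nearer to the root. -/
def Edge.near {T : DecoTree V R} (e : T.Edge) : V := e.1.fst

/-- The vertex of an edge that is farther from the root. -/
def Edge.far {T : DecoTree V R} (e : T.Edge) : V := e.1.snd

/-- The edges with their direction away from the root are exactly the edges of the graph. -/
theorem edge_bijective (T : DecoTree V R) :
    Function.Bijective (fun e : T.Edge => (⟨e.1.edge, e.1.edge_mem⟩ : T.graph.edgeSet)) := by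
  constructor
  · rintro ⟨d, hd⟩ ⟨d', hd'⟩ h
    have h' : d.edge = d'.edge := congrArg Subtype.val h
    rcases (SimpleGraph.dart_edge_eq_iff d d').mp h' with rfl | rfl
    · rfl
    · exact absurd hd (lt_asymm hd')
  · rintro ⟨e, he⟩
    induction e using Sym2.ind with
    | _ v w =>
      have hvw : T.graph.Adj v w := he
      rcases lt_or_gt_of_ne (T.isTree.dist_ne_of_adj T.root hvw) with h | h
      · exact ⟨⟨⟨(v, w), hvw⟩, h⟩, rfl⟩
      · exact ⟨⟨⟨(w, v), hvw.symm⟩, h⟩, Subtype.ext Sym2.eq_swap⟩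

/-- Two orderings of the (`n`-element) set of edges that differ by an even permutation. -/
def orientationSetoid (T : DecoTree V R) (n : ℕ) : Setoid (Fin n ≃ T.Edge) where
  r o o' := ∃ σ : Equiv.Perm (Fin n), Equiv.Perm.sign σ = 1 ∧ o' = σ.trans o
  iseqv :=
    { refl := fun o => ⟨1, by simp, by ext; rfl⟩
      symm := by
        rintro o _ ⟨σ, hσ, rfl⟩
        exact ⟨σ⁻¹, by simp [hσ], by ext i; simp⟩
      trans := by
        rintro o _ _ ⟨σ, hσ, rfl⟩ ⟨τ, hτ, rfl⟩
        exact ⟨σ * τ, by simp [hσ, hτ], by ext i; simp⟩ }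

/-- The orientation torsor of a tree with `n` edges: orderings of the edges up to even
permutations. -/
def Orientation (T : DecoTree V R) (n : ℕ) : Type _ := Quotient (T.orientationSetoid n)

/-! ### The forest cycling map on trees -/

variable {F : Type*} [Field F]

/-- The function field `F(t_v : v an internal vertex)` of the parameter space. -/
abbrev ParamField (T : DecoTree V Fˣ) : Type _ :=
  FractionRing (MvPolynomial {v : V // ¬ T.IsExternal v} F)

open Classical in
/-- The decoration of all vertices: the given constants at external vertices, and independent
variables at internal vertices. -/
def label (T : DecoTree V Fˣ) (v : V) : T.ParamField :=
  if h : T.IsExternal v then algebraMap F T.ParamField (T.deco ⟨v, h⟩ : F)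
  else algebraMap (MvPolynomial {v : V // ¬ T.IsExternal v} F) T.ParamField (MvPolynomial.X ⟨v, h⟩)

theorem label_ne_zero (T : DecoTree V Fˣ) (v : V) : T.label v ≠ 0 := by
  unfold label
  split_ifs with h
  · exact (map_ne_zero _).mpr (T.deco ⟨v, h⟩).ne_zero
  · exact (map_ne_zero_iff _ (IsFractionRing.injective _ _)).mpr (MvPolynomial.X_ne_zero _)

/-- The coordinate `1 - y_v / y_w` in `ℙ¹ ∖ {1}` of an edge from `v` to `w`, directed away from the
root. -/
def edgeCoord (T : DecoTree V Fˣ) (e : T.Edge) :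
    {z : OnePoint T.ParamField // z ≠ ((1 : T.ParamField) : OnePoint T.ParamField)} :=
  ⟨((1 - T.label e.near / T.label e.far : T.ParamField) : OnePoint T.ParamField), fun h =>
    div_ne_zero (T.label_ne_zero e.near) (T.label_ne_zero e.far)
      (sub_eq_self.mp (OnePoint.coe_injective h))⟩

/-- The subvariety of `□_F^n` parametrized by the coordinates of the edges, concatenated in the
given ordering: the closure of the image of the generic point of the parameter space. -/
def subvariety (T : DecoTree V Fˣ) {n : ℕ} (o : Fin n ≃ T.Edge) :
    TopologicalSpace.IrreducibleCloseds (Cube F n) where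
  carrier := closure {cubePoint F fun i => T.edgeCoord (o i)}
  isIrreducible' := isIrreducible_singleton.closure
  isClosed' := isClosed_closure

/-- Permuting the ordering of the edges permutes the coordinates of the subvariety. -/
theorem subvariety_trans (T : DecoTree V Fˣ) {n : ℕ} (o : Fin n ≃ T.Edge)
    (σ : Equiv.Perm (Fin n)) :
    ((T.subvariety (σ.trans o)) : Set (Cube F n)) =
      cubeAct F σ (fun _ => false) '' (T.subvariety o : Set (Cube F n)) := by
  have hsurj : Function.Surjective (cubeActHom F σ fun _ => false).toRingHom := by
    intro p
    refine ⟨MvPolynomial.rename σ.symm p, ?_⟩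
    change cubeActHom F σ (fun _ => false) (MvPolynomial.rename σ.symm p) = p
    rw [cubeActHom, MvPolynomial.aeval_rename]
    simp [Function.comp_def]
  have hpt : cubeAct F σ (fun _ => false) (cubePoint F fun i => T.edgeCoord (o i)) =
      cubePoint F fun i => T.edgeCoord ((σ.trans o) i) := by
    apply PrimeSpectrum.ext
    ext p
    change MvPolynomial.aeval _ (cubeActHom F σ (fun _ => false) p) = 0 ↔
      MvPolynomial.aeval _ p = 0
    rw [cubeActHom, ← AlgHom.comp_apply, MvPolynomial.comp_aeval]
    simp
  have hcl := (PrimeSpectrum.isClosedEmbedding_comap_of_surjective _ _ hsurj).closure_image_eq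
    {cubePoint F fun i => T.edgeCoord (o i)}
  rw [Set.image_singleton] at hcl
  change closure {cubePoint F fun i => T.edgeCoord ((σ.trans o) i)} = _
  rw [← hpt]
  exact hcl

/-- The forest cycling map on the generator `(T, ω)`: the cycle of the parametrized subvariety, for
any ordering of the edges that represents `ω`. -/
def forestCycling (T : DecoTree V Fˣ) {n : ℕ} (ω : T.Orientation n) : AllCycles F n :=
  Quotient.lift
    (fun o : Fin n ≃ T.Edge =>
      (cycleClass ⟨T.subvariety o, Set.mem_univ _⟩ : AllCycles F n))
    (by
      rintro o _ ⟨σ, hσ, rfl⟩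
      have h := cycleClass_eq_of_act (S := Set.univ) (Z := ⟨T.subvariety o, Set.mem_univ _⟩)
        (W := ⟨T.subvariety (σ.trans o), Set.mem_univ _⟩) σ _ (T.subvariety_trans o σ)
      simpa [cubeSign, hσ] using h.symm) ω

end DecoTree

end CubicalCycles

end

/-!
In the coordinates `u = 1 - s` the edge from `v` to `w` has `u = y_w / y_v`, the faces `z = 0` and
`z = ∞` become `u = 1` and `u = 0`, and the product of the `u` along the path from the root to an
external vertex `x` is the quotient of the decorations of `x` and of the root (`pathEquation`).
Conversely, if there are `p` leaves, a point at which the `p` equations for the leaves hold comes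
from a labelling of the vertices by nonzero elements that extends the decoration
(`exists_eq_ratioPoint`): up to the decoration of the root the labels are the path products, and
none of them vanishes because each divides the product at some leaf. So the
subvariety of the tree is a torus, closed in the cube, and it misses every face with a coordinate
`∞`. On a face `z_i = 0`, `i ∈ I`, the labels at the two ends of each edge of `I` agree; if the
intersection is nonempty, genericity prevents two external vertices from being joined by edges of
`I`, and the intersection is the torus of labellings that are constant on the classes of joined
vertices (`exists_subvariety_inter_face_eq`). Its generic point comes from independent variables on
the classes without external vertex; that it specializes to all other points is
`ker_aeval_div_le`.

This torus is cut out in the face by `p` equations, so Krull's height theorem bounds its codimension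
by `p` (`codimIn_pointClosure_le`). In the other direction, replacing the constants at the leaves
by new variables one after the other gives a strict chain of length `p` of irreducible closed
subsets of the face (`le_codimIn_fibrePoint`).
-/

noncomputable section

namespace CubicalCycles

open MvPolynomial TopologicalSpace

/-! ### Specialization of parametrized points -/

/-- Rational functions satisfy every polynomial relation after a specialization at which none of
their denominators vanishes: all the fractions lie in the local ring of the parameter space at the
specialized point. -/
theorem ker_aeval_div_le {F R K κ ι : Type*} [Field F] [CommRing R] [IsDomain R] [Algebra F R]
    [Field K] [Algebra R K] [IsFractionRing R K] [Algebra F K] [IsScalarTower F R K]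
    [Field κ] [Algebra F κ] (φ : R →ₐ[F] κ) (a b : ι → R) (hb : ∀ i, φ (b i) ≠ 0) :
    RingHom.ker (aeval (fun i => 1 - algebraMap R K (a i) / algebraMap R K (b i)) :
      MvPolynomial ι F →ₐ[F] K) ≤
    RingHom.ker (aeval (fun i => 1 - φ (a i) / φ (b i)) : MvPolynomial ι F →ₐ[F] κ) := by
  let q : Ideal R := RingHom.ker φ
  have hq : q.IsPrime := RingHom.ker_isPrime _
  have hφ : ∀ s : q.primeCompl, IsUnit (φ s) := fun s => isUnit_iff_ne_zero.mpr s.2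
  have hK : ∀ s : q.primeCompl, IsUnit (IsScalarTower.toAlgHom F R K s) := fun s => by
    refine isUnit_iff_ne_zero.mpr ((map_ne_zero_iff _ (IsFractionRing.injective R K)).mpr ?_)
    intro h0
    exact s.2 (by rw [h0]; exact q.zero_mem)
  let ψ : Localization.AtPrime q →ₐ[F] κ := IsLocalization.liftAlgHom (M := q.primeCompl) hφ
  let j : Localization.AtPrime q →ₐ[F] K := IsLocalization.liftAlgHom (M := q.primeCompl) hK
  have hψ : ∀ r : R, ψ (algebraMap R _ r) = φ r := fun r => IsLocalization.lift_eq _ r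
  have hj : ∀ r : R, j (algebraMap R _ r) = algebraMap R K r := fun r => IsLocalization.lift_eq _ r
  have hjinj : Function.Injective j := by
    rw [injective_iff_map_eq_zero]
    intro z hz
    obtain ⟨r, s, rfl⟩ := IsLocalization.exists_mk'_eq q.primeCompl z
    have h1 : j (algebraMap R _ r) = 0 := by
      rw [← IsLocalization.mk'_spec (Localization.AtPrime q) r s, map_mul, hz, zero_mul]
    rw [hj, map_eq_zero_iff _ (IsFractionRing.injective R K)] at h1
    rw [h1, IsLocalization.mk'_zero]
  let x : ι → Localization.AtPrime q := fun i => 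
    1 - IsLocalization.mk' _ (a i) (⟨b i, hb i⟩ : q.primeCompl)
  have hxj : ∀ i, j (x i) = 1 - algebraMap R K (a i) / algebraMap R K (b i) := by
    intro i
    have hb' : algebraMap R K (b i) ≠ 0 := (hK ⟨b i, hb i⟩).ne_zero
    rw [map_sub, map_one, sub_right_inj, eq_div_iff hb', ← hj, ← hj, ← map_mul]
    exact congrArg j (IsLocalization.mk'_spec _ (a i) (⟨b i, hb i⟩ : q.primeCompl))
  have hxψ : ∀ i, ψ (x i) = 1 - φ (a i) / φ (b i) := by
    intro i
    rw [map_sub, map_one, sub_right_inj, eq_div_iff (hb i), ← hψ, ← hψ, ← map_mul]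
    exact congrArg ψ (IsLocalization.mk'_spec _ (a i) (⟨b i, hb i⟩ : q.primeCompl))
  intro f hf
  rw [RingHom.mem_ker] at hf ⊢
  simp only [← hxj] at hf
  simp only [← hxψ]
  rw [← MvPolynomial.comp_aeval_apply] at hf ⊢
  rw [(map_eq_zero_iff j hjinj).mp hf, map_zero]

/-! ### Codimension in a closed subset of a spectrum -/

/-- The irreducible closed subset with a given generic point. -/
def pointClosure {X : Type*} [TopologicalSpace X] (x : X) : IrreducibleCloseds X where
  carrier := closure {x}
  isIrreducible' := isIrreducible_singleton.closure
  isClosed' := isClosed_closure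

theorem coe_pointClosure {X : Type*} [TopologicalSpace X] (x : X) :
    (pointClosure x : Set X) = closure {x} := rfl

theorem mem_pointClosure_iff {A : Type*} [CommRing A] (P Q : PrimeSpectrum A) :
    Q ∈ (pointClosure P : Set (PrimeSpectrum A)) ↔ P ≤ Q := by
  rw [PrimeSpectrum.le_iff_specializes, specializes_iff_mem_closure]
  rfl

theorem pointClosure_lt_pointClosure {A : Type*} [CommRing A] {P Q : PrimeSpectrum A} (h : P < Q) :
    pointClosure Q < pointClosure P := by
  have h1 : ∀ P Q : PrimeSpectrum A, pointClosure Q ≤ pointClosure P ↔ P ≤ Q := fun P Q => by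
    rw [PrimeSpectrum.le_iff_specializes, specializes_iff_closure_subset]
    rfl
  exact lt_of_le_not_ge ((h1 _ _).mpr h.le) fun h2 => h.not_ge ((h1 _ _).mp h2)

/-- Krull's height theorem, for codimension in a closed subset `V(s)`: a component of the locus cut
out in `V(s)` by the equations in `t` has codimension at most the number of those equations. -/
theorem codimIn_pointClosure_le {A : Type*} [CommRing A] [IsNoetherianRing A] {s t : Set A}
    (ht : t.Finite) {P : PrimeSpectrum A} (hP : P.asIdeal ∈ (Ideal.span (s ∪ t)).minimalPrimes)
    (h : (pointClosure P : Set (PrimeSpectrum A)) ⊆ PrimeSpectrum.zeroLocus s) :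
    codimIn (PrimeSpectrum.zeroLocus s) (pointClosure P) h ≤ t.ncard := by
  let J := Ideal.span s
  have hsurj : Function.Surjective (Ideal.Quotient.mk J) := Ideal.Quotient.mk_surjective
  have hcm : ∀ K : Ideal A, J ≤ K → (K.map (Ideal.Quotient.mk J)).comap (Ideal.Quotient.mk J) = K :=
    fun K hK => by
      rw [Ideal.comap_map_of_surjective _ hsurj, ← RingHom.ker_eq_comap_bot, Ideal.mk_ker,
        sup_eq_left.mpr hK]
  have hle : ∀ W : {W : IrreducibleCloseds (PrimeSpectrum A) //
      (W : Set (PrimeSpectrum A)) ⊆ PrimeSpectrum.zeroLocus s},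
      J ≤ PrimeSpectrum.vanishingIdeal (W.1 : Set (PrimeSpectrum A)) := fun W => by
    rw [← PrimeSpectrum.subset_zeroLocus_iff_le_vanishingIdeal, PrimeSpectrum.zeroLocus_span]
    exact W.2
  -- A closed subset of `V(s)` corresponds to the image of its vanishing ideal in `A / (s)`; on
  -- ideals containing `(s)` this loses nothing, so strict inclusions are reversed strictly.
  have hprime : ∀ W : {W : IrreducibleCloseds (PrimeSpectrum A) //
      (W : Set (PrimeSpectrum A)) ⊆ PrimeSpectrum.zeroLocus s},
      ((PrimeSpectrum.vanishingIdeal (W.1 : Set (PrimeSpectrum A))).map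
        (Ideal.Quotient.mk J)).IsPrime := fun W => by
    have := PrimeSpectrum.isIrreducible_iff_vanishingIdeal_isPrime.mp W.1.isIrreducible
    exact Ideal.isPrime_map_quotientMk_of_isPrime (hle W)
  let f : {W : IrreducibleCloseds (PrimeSpectrum A) //
      (W : Set (PrimeSpectrum A)) ⊆ PrimeSpectrum.zeroLocus s} → (PrimeSpectrum (A ⧸ J))ᵒᵈ :=
    fun W => OrderDual.toDual ⟨_, hprime W⟩
  have hf : StrictMono f := by
    intro W W' hlt
    have hle' : PrimeSpectrum.vanishingIdeal (W'.1 : Set (PrimeSpectrum A)) ≤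
        PrimeSpectrum.vanishingIdeal (W.1 : Set (PrimeSpectrum A)) :=
      PrimeSpectrum.vanishingIdeal_anti_mono hlt.le
    refine lt_of_le_of_ne (show f W ≤ f W' from Ideal.map_mono hle') fun heq => ?_
    have h1 := congrArg (fun p => (OrderDual.ofDual p).asIdeal.comap (Ideal.Quotient.mk J)) heq
    simp only [f, OrderDual.ofDual_toDual] at h1
    rw [hcm _ (hle W), hcm _ (hle W')] at h1
    refine hlt.not_ge ((PrimeSpectrum.vanishingIdeal_anti_mono_iff W.1.isClosed).mpr h1.le)
  have hJP : J ≤ P.asIdeal := (Ideal.span_mono Set.subset_union_left).trans hP.1.2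
  have hv : PrimeSpectrum.vanishingIdeal (pointClosure P : Set (PrimeSpectrum A)) = P.asIdeal := by
    rw [coe_pointClosure, PrimeSpectrum.vanishingIdeal_closure,
      PrimeSpectrum.vanishingIdeal_singleton]
  have hmin : P.asIdeal.map (Ideal.Quotient.mk J) ∈
      (Ideal.span (Ideal.Quotient.mk J '' t)).minimalPrimes := by
    refine ⟨⟨Ideal.isPrime_map_quotientMk_of_isPrime hJP, ?_⟩, ?_⟩
    · rw [← Ideal.map_span]
      exact Ideal.map_mono ((Ideal.span_mono Set.subset_union_right).trans hP.1.2)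
    · rintro Q ⟨hQ, htQ⟩ hQP
      rw [Ideal.map_le_iff_le_comap]
      refine hP.2 ⟨hQ.comap _, ?_⟩ ((Ideal.comap_mono hQP).trans_eq (hcm _ hJP))
      rw [Ideal.span_le, Set.union_subset_iff]
      constructor
      · intro a ha
        rw [SetLike.mem_coe, Ideal.mem_comap,
          Ideal.Quotient.eq_zero_iff_mem.mpr (Ideal.subset_span ha)]
        exact Q.zero_mem
      · exact fun a ha => htQ (Ideal.subset_span (Set.mem_image_of_mem _ ha))
  calc codimIn (PrimeSpectrum.zeroLocus s) (pointClosure P) h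
      ≤ Order.coheight (f ⟨pointClosure P, h⟩) :=
        Order.coheight_le_coheight_apply_of_strictMono f hf _
    _ = (P.asIdeal.map (Ideal.Quotient.mk J)).height := by
        simp only [f, Order.coheight_toDual, ← PrimeSpectrum.height_eq_orderHeight, hv]
    _ ≤ (Ideal.Quotient.mk J '' t).ncard :=
        Ideal.height_le_card_of_mem_minimalPrimes_span (ht.image _) hmin
    _ ≤ t.ncard := by exact_mod_cast Set.ncard_image_le ht

namespace DecoTree

variable {V : Type*} [Finite V] {R : Type*}

/-! ### Combinatorics of rooted trees -/

theorem adj_near_far (T : DecoTree V R) (e : T.Edge) : T.graph.Adj e.near e.far := e.1.adj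

theorem dist_far (T : DecoTree V R) (e : T.Edge) :
    T.graph.dist T.root e.far = T.graph.dist T.root e.near + 1 := by
  have h := T.isTree.dist_eq_dist_add_one_of_adj T.root (T.adj_near_far e)
  have h' : T.graph.dist T.root e.near < T.graph.dist T.root e.far := e.2
  omega

theorem far_ne_root (T : DecoTree V R) (e : T.Edge) : e.far ≠ T.root := by
  intro h
  have := T.dist_far e
  rw [h, SimpleGraph.dist_self] at this
  omega

/-- Every vertex of a tree has at most one edge towards the root. -/
theorem far_injective (T : DecoTree V R) : Function.Injective (Edge.far : T.Edge → V) := by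
  have key : ∀ e : T.Edge, ∃ p : T.graph.Walk T.root e.far, p.IsPath ∧ p.penultimate = e.near := by
    intro e
    obtain ⟨p, hp⟩ := T.isTree.connected.exists_walk_length_eq_dist T.root e.near
    refine ⟨p.concat (T.adj_near_far e),
      SimpleGraph.Walk.isPath_of_length_eq_dist _ ?_, by simp⟩
    rw [SimpleGraph.Walk.length_concat, hp]
    exact (T.dist_far e).symm
  intro e e' h
  obtain ⟨p, hp, hpe⟩ := key e
  obtain ⟨p', hp', hpe'⟩ := key e'
  have hn : e.near = e'.near := by
    rw [← hpe, ← hpe']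
    clear hpe hpe'
    revert p p'
    rw [h]
    intro p hp p' hp'
    rw [(T.isTree.existsUnique_path _ _).unique hp hp']
  exact Subtype.ext (SimpleGraph.Dart.ext _ _ (Prod.ext hn h))

theorem exists_far_eq (T : DecoTree V R) {v : V} (hv : v ≠ T.root) : ∃ e : T.Edge, e.far = v := by
  obtain ⟨p, hp⟩ := T.isTree.connected.exists_walk_length_eq_dist T.root v
  have hnil : ¬ p.Nil := SimpleGraph.Walk.not_nil_of_ne hv.symm
  have hadj := p.adj_penultimate hnil
  refine ⟨⟨⟨(p.penultimate, v), hadj⟩, ?_⟩, rfl⟩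
  have h1 := T.graph.dist_le p.dropLast
  have h2 : p.dropLast.length + 1 = p.length := p.length_dropLast_add_one hnil
  change T.graph.dist T.root p.penultimate < T.graph.dist T.root v
  omega

/-- Each vertex that is not a leaf has an edge away from the root. -/
theorem exists_near_eq (T : DecoTree V R) {v : V} (hv : T.IsExternal v → v = T.root) :
    ∃ e : T.Edge, e.near = v := by
  have key : ∀ w, T.graph.Adj v w →
      (∃ e : T.Edge, e.near = v) ∨ ∃ e : T.Edge, e.near = w ∧ e.far = v := fun w hw => by
    rcases lt_or_gt_of_ne (T.isTree.dist_ne_of_adj T.root hw) with h | h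
    · exact Or.inl ⟨⟨⟨(v, w), hw⟩, h⟩, rfl⟩
    · exact Or.inr ⟨⟨⟨(w, v), hw.symm⟩, h⟩, rfl, rfl⟩
  -- Only one of the edges at `v` can lead towards the root, and none can if `v` is the root.
  by_cases hr : v = T.root
  · obtain ⟨w, hw⟩ := (Set.ncard_eq_one.mp T.root_external)
    have hadj : w ∈ T.graph.neighborSet T.root := by rw [hw]; rfl
    rw [← hr] at hadj
    rcases key w hadj with h | ⟨e, -, he⟩
    · exact h
    · exact absurd (he.trans hr) (T.far_ne_root e)
  · have h3 : 3 ≤ (T.graph.neighborSet v).ncard :=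
      (T.valency v).resolve_left fun h => hr (hv h)
    obtain ⟨w, hw, w', hw', hne⟩ := (Set.one_lt_ncard (Set.toFinite _)).mp (by omega :
      1 < (T.graph.neighborSet v).ncard)
    rcases key w hw with h | ⟨e, he1, he2⟩
    · exact h
    rcases key w' hw' with h | ⟨e', he1', he2'⟩
    · exact h
    · have := T.far_injective (he2.trans he2'.symm)
      exact absurd (he1.symm.trans ((congrArg Edge.near this).trans he1')) hne

/-- Induction along the edges, away from the root. -/
theorem induction_from_root (T : DecoTree V R) {P : V → Prop} (hroot : P T.root)
    (hstep : ∀ e : T.Edge, P e.near → P e.far) (v : V) : P v := by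
  induction h : T.graph.dist T.root v generalizing v with
  | zero => rwa [← (T.isTree.connected.dist_eq_zero_iff).mp h]
  | succ d ih =>
    obtain ⟨e, rfl⟩ := T.exists_far_eq (v := v) (by rintro rfl; simp at h)
    exact hstep e (ih _ (by rw [T.dist_far] at h; omega))

/-- Induction along the edges, from the leaves towards the root. -/
theorem induction_from_leaves (T : DecoTree V R) {P : V → Prop}
    (hleaf : ∀ v, T.IsExternal v → v ≠ T.root → P v)
    (hstep : ∀ e : T.Edge, P e.far → P e.near) (v : V) : P v := by
  have : IsTrans V fun v w => T.graph.dist T.root w < T.graph.dist T.root v :=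
    ⟨fun _ _ _ h h' => h'.trans h⟩
  have : Std.Irrefl fun v w => T.graph.dist T.root w < T.graph.dist T.root v :=
    ⟨fun _ => lt_irrefl _⟩
  induction v using (Finite.wellFounded_of_trans_of_irrefl
    fun v w => T.graph.dist T.root w < T.graph.dist T.root v).induction with
  | _ v ih =>
    by_cases h : T.IsExternal v ∧ v ≠ T.root
    · exact hleaf v h.1 h.2
    · obtain ⟨e, rfl⟩ := T.exists_near_eq (v := v) (by tauto)
      exact hstep e (ih _ (by rw [T.dist_far]; omega))

theorem exists_pathProd (T : DecoTree V R) {M : Type*} [Monoid M] (w : T.Edge → M) :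
    ∃ y : V → M, y T.root = 1 ∧ ∀ e : T.Edge, y e.far = y e.near * w e := by
  classical
  -- The function is built by distance from the root; each vertex at distance `d + 1` is the far end
  -- of exactly one edge.
  have key : ∀ d : ℕ, ∃ y : V → M, y T.root = 1 ∧
      ∀ e : T.Edge, T.graph.dist T.root e.far ≤ d → y e.far = y e.near * w e := by
    intro d
    induction d with
    | zero => exact ⟨1, rfl, fun e h => by rw [T.dist_far] at h; omega⟩
    | succ d ih =>
      obtain ⟨y, hy, hye⟩ := ih
      let y' : V → M := fun v =>
        if h : T.graph.dist T.root v = d + 1 ∧ ∃ e : T.Edge, e.far = v then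
          y h.2.choose.near * w h.2.choose else y v
      have hy' : ∀ v, T.graph.dist T.root v ≠ d + 1 → y' v = y v := fun v hv =>
        dif_neg fun h => hv h.1
      refine ⟨y', (hy' _ (by simp)).trans hy, fun e he => ?_⟩
      have hd := T.dist_far e
      rw [hy' e.near (by omega)]
      by_cases hed : T.graph.dist T.root e.far = d + 1
      · have hex : T.graph.dist T.root e.far = d + 1 ∧ ∃ e' : T.Edge, e'.far = e.far :=
          ⟨hed, e, rfl⟩
        have h1 : y' e.far = y hex.2.choose.near * w hex.2.choose := dif_pos hex
        rw [h1, T.far_injective hex.2.choose_spec]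
      · rw [hy' _ hed]
        exact hye e (by omega)
  obtain ⟨d, hd⟩ := (Set.finite_range (T.graph.dist T.root)).bddAbove
  obtain ⟨y, hy, hye⟩ := key d
  exact ⟨y, hy, fun e => hye e (hd ⟨_, rfl⟩)⟩

/-- For weights `w` on the edges, the product of the weights along the path from the root to a
vertex. -/
def pathProd (T : DecoTree V R) {M : Type*} [Monoid M] (w : T.Edge → M) : V → M :=
  (T.exists_pathProd w).choose

theorem pathProd_root (T : DecoTree V R) {M : Type*} [Monoid M] (w : T.Edge → M) :
    T.pathProd w T.root = 1 := (T.exists_pathProd w).choose_spec.1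

theorem pathProd_far (T : DecoTree V R) {M : Type*} [Monoid M] (w : T.Edge → M) (e : T.Edge) :
    T.pathProd w e.far = T.pathProd w e.near * w e := (T.exists_pathProd w).choose_spec.2 e

end DecoTree

namespace DecoTree

variable {V : Type*} [Finite V] {F : Type*} [Field F] {n : ℕ}

/-! ### Points of the cube with given vertex labels -/

/-- The set of external vertices. -/
def externals (T : DecoTree V Fˣ) : Set V := {v | T.IsExternal v}

/-- The set of leaves. -/
def leaves (T : DecoTree V Fˣ) : Set V := {v | T.IsExternal v ∧ v ≠ T.root}

open Classical in
/-- The decoration, extended to internal vertices by the value `1`. -/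
def weight (T : DecoTree V Fˣ) (v : V) : F := if h : T.IsExternal v then T.deco ⟨v, h⟩ else 1

theorem weight_ne_zero (T : DecoTree V Fˣ) (v : V) : T.weight v ≠ 0 := by
  unfold weight
  split_ifs
  · exact Units.ne_zero _
  · exact one_ne_zero

theorem IsGeneric.eq_of_weight_eq {T : DecoTree V Fˣ} (hT : T.IsGeneric) {v w : V}
    (hv : T.IsExternal v) (hw : T.IsExternal w) (h : T.weight v = T.weight w) : v = w := by
  rw [weight, weight, dif_pos hv, dif_pos hw] at h
  exact congrArg Subtype.val (hT (Units.ext h))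

/-- For a labelling `y` of the vertices in an extension field of `F`, the point of the cube whose
coordinate `z = 1 - y_v / y_w` at an edge from `v` to `w` corresponds to `s = 1 - y_w / y_v`. -/
def ratioPoint (T : DecoTree V Fˣ) (o : Fin n ≃ T.Edge) {κ : Type*} [Field κ] [Algebra F κ]
    (y : V → κ) : Cube F n :=
  ⟨RingHom.ker (aeval (fun i => 1 - y (o i).far / y (o i).near) : MvPolynomial (Fin n) F →ₐ[F] κ),
    RingHom.ker_isPrime _⟩

theorem mem_ratioPoint (T : DecoTree V Fˣ) (o : Fin n ≃ T.Edge) {κ : Type*} [Field κ]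
    [Algebra F κ] (y : V → κ) (f : MvPolynomial (Fin n) F) :
    f ∈ (T.ratioPoint o y).asIdeal ↔
      aeval (fun i => 1 - y (o i).far / y (o i).near) f = 0 := Iff.rfl

theorem ratioPoint_le_of_specialization (T : DecoTree V Fˣ) (o : Fin n ≃ T.Edge) {A K κ : Type*}
    [CommRing A] [IsDomain A] [Algebra F A] [Field K] [Algebra A K] [IsFractionRing A K]
    [Algebra F K] [IsScalarTower F A K] [Field κ] [Algebra F κ] (φ : A →ₐ[F] κ) (y : V → A)
    (hy : ∀ v, φ (y v) ≠ 0) :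
    T.ratioPoint o (fun v => algebraMap A K (y v)) ≤ T.ratioPoint o (fun v => φ (y v)) :=
  ker_aeval_div_le φ (fun i => y (o i).far) (fun i => y (o i).near) fun _ => hy _

theorem cubePoint_edgeCoord (T : DecoTree V Fˣ) (o : Fin n ≃ T.Edge) :
    cubePoint F (fun i => T.edgeCoord (o i)) = T.ratioPoint o T.label := by
  have h : ∀ e : T.Edge, cubeCoord T.ParamField (T.edgeCoord e) =
      1 - T.label e.far / T.label e.near := fun e => by
    have h1 := T.label_ne_zero e.near
    have h2 := T.label_ne_zero e.far
    change (1 - T.label e.near / T.label e.far) / (1 - T.label e.near / T.label e.far - 1) = _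
    rw [sub_sub_cancel_left]
    field_simp
    ring
  simp only [cubePoint, ratioPoint, h]

/-- The product of the functions `1 - s_e` along the path from the root to a vertex. -/
def pathPoly (T : DecoTree V Fˣ) (o : Fin n ≃ T.Edge) : V → MvPolynomial (Fin n) F :=
  T.pathProd fun e => 1 - X (o.symm e)

/-- The equation satisfied by the path product at an external vertex: it is the quotient of the
decoration by that of the root. -/
def pathEquation (T : DecoTree V Fˣ) (o : Fin n ≃ T.Edge) (v : V) : MvPolynomial (Fin n) F :=
  C (T.weight v) - C (T.weight T.root) * T.pathPoly o v

theorem mul_aeval_pathPoly (T : DecoTree V Fˣ) (o : Fin n ≃ T.Edge) {κ : Type*} [Field κ]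
    [Algebra F κ] {y : V → κ} (hy : ∀ v, y v ≠ 0) (v : V) :
    y T.root * aeval (fun i => 1 - y (o i).far / y (o i).near) (T.pathPoly o v) = y v := by
  induction v using T.induction_from_root with
  | hroot => rw [pathPoly, pathProd_root, map_one, mul_one]
  | hstep e ih =>
    rw [pathPoly, pathProd_far, map_mul, ← mul_assoc, ← pathPoly, ih, map_sub, map_one, aeval_X,
      sub_sub_cancel, o.apply_symm_apply, mul_div_cancel₀ _ (hy _)]

theorem pathEquation_mem_ratioPoint_iff (T : DecoTree V Fˣ) (o : Fin n ≃ T.Edge) {κ : Type*}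
    [Field κ] [Algebra F κ] {y : V → κ} (hy : ∀ v, y v ≠ 0)
    (hroot : y T.root = algebraMap F κ (T.weight T.root)) (v : V) :
    T.pathEquation o v ∈ (T.ratioPoint o y).asIdeal ↔ y v = algebraMap F κ (T.weight v) := by
  rw [mem_ratioPoint, pathEquation, map_sub, map_mul, aeval_C, aeval_C, ← hroot,
    T.mul_aeval_pathPoly o hy, sub_eq_zero, eq_comm]

/-- A point that satisfies the path equations at the leaves comes from a labelling that extends the
decoration: no path product vanishes at it, since each divides the path product at some leaf. -/
theorem exists_eq_ratioPoint (T : DecoTree V Fˣ) (o : Fin n ≃ T.Edge) (Q : Cube F n)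
    (hQ : ∀ x ∈ T.leaves, T.pathEquation o x ∈ Q.asIdeal) :
    ∃ y : V → Q.asIdeal.ResidueField, (∀ v, y v ≠ 0) ∧
      (∀ v, T.IsExternal v → y v = algebraMap F _ (T.weight v)) ∧ Q = T.ratioPoint o y := by
  let κ := Q.asIdeal.ResidueField
  let θ : MvPolynomial (Fin n) F →ₐ[F] κ := IsScalarTower.toAlgHom F _ _
  have hker : ∀ f, f ∈ Q.asIdeal ↔ θ f = 0 := fun f => by
    conv_lhs => rw [← Ideal.ker_algebraMap_residueField Q.asIdeal]
    rfl
  let y : V → κ := fun v => algebraMap F κ (T.weight T.root) * θ (T.pathPoly o v)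
  have hyfar : ∀ e : T.Edge, y e.far = y e.near * (1 - θ (X (o.symm e))) := fun e => by
    simp only [y, pathPoly, pathProd_far, map_mul, map_sub, map_one, mul_assoc]
  have hyext : ∀ v, T.IsExternal v → y v = algebraMap F κ (T.weight v) := by
    intro v hv
    by_cases hr : v = T.root
    · simp only [y, hr, pathPoly, pathProd_root, map_one, mul_one]
    · have h := (hker _).mp (hQ v ⟨hv, hr⟩)
      rw [pathEquation, map_sub, map_mul, sub_eq_zero, ← algebraMap_eq, AlgHom.commutes,
        AlgHom.commutes] at h
      exact h.symm
  have hy0 : ∀ v, y v ≠ 0 := by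
    intro v
    induction v using T.induction_from_leaves with
    | hleaf v hv _ =>
      rw [hyext v hv]
      exact (map_ne_zero _).mpr (T.weight_ne_zero v)
    | hstep e ih => exact left_ne_zero_of_mul (hyfar e ▸ ih)
  refine ⟨y, hy0, hyext, PrimeSpectrum.ext (Ideal.ext fun f => ?_)⟩
  have hθ : θ = aeval (fun i => 1 - y (o i).far / y (o i).near) := by
    refine MvPolynomial.algHom_ext fun i => ?_
    rw [aeval_X, hyfar, mul_div_cancel_left₀ _ (hy0 _), o.symm_apply_apply, sub_sub_cancel]
  rw [hker, mem_ratioPoint, hθ]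

/-- The universal labelling with constant labels on `S` and independent variables elsewhere. -/
def partialLabel (T : DecoTree V Fˣ) (S : Set V) (v : V) : MvPolynomial V F :=
  open Classical in if v ∈ S then C (T.weight v) else X v

theorem partialLabel_ne_zero (T : DecoTree V Fˣ) (S : Set V) (v : V) : T.partialLabel S v ≠ 0 := by
  unfold partialLabel
  split_ifs
  · exact C_ne_zero.mpr (T.weight_ne_zero v)
  · exact X_ne_zero v

theorem aeval_partialLabel (T : DecoTree V Fˣ) {S : Set V} {κ : Type*} [Field κ] [Algebra F κ]
    {y : V → κ} (hS : ∀ v ∈ S, y v = algebraMap F κ (T.weight v)) (v : V) :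
    aeval y (T.partialLabel S v) = y v := by
  unfold partialLabel
  split_ifs with h
  · rw [aeval_C, hS v h]
  · rw [aeval_X]

/-- The universal labelling that is constant on the fibres of `q` and takes the prescribed values
on `S`. -/
def fibreLabel (T : DecoTree V Fˣ) (q : V → V) (S : Set V) (v : V) :
    FractionRing (MvPolynomial V F) :=
  algebraMap _ _ (T.partialLabel S (q v))

/-- The generic point of the locus parametrized by the labellings that are constant on the fibres
of `q` and take the prescribed values on `S`. -/
def fibrePoint (T : DecoTree V Fˣ) (o : Fin n ≃ T.Edge) (q : V → V) (S : Set V) : Cube F n :=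
  T.ratioPoint o (T.fibreLabel q S)

theorem fibreLabel_ne_zero (T : DecoTree V Fˣ) (q : V → V) (S : Set V) (v : V) :
    T.fibreLabel q S v ≠ 0 :=
  (map_ne_zero_iff _ (IsFractionRing.injective _ _)).mpr (T.partialLabel_ne_zero S _)

theorem fibreLabel_of_mem (T : DecoTree V Fˣ) {q : V → V} {S : Set V} {v : V} (hv : q v ∈ S) :
    T.fibreLabel q S v = algebraMap F _ (T.weight (q v)) := by
  rw [fibreLabel, partialLabel, if_pos hv, ← algebraMap_eq,
    ← IsScalarTower.algebraMap_apply]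

theorem fibrePoint_le_ratioPoint (T : DecoTree V Fˣ) (o : Fin n ≃ T.Edge) {q : V → V} {S : Set V}
    {κ : Type*} [Field κ] [Algebra F κ] {y : V → κ} (hy : ∀ v, y v ≠ 0)
    (hS : ∀ v ∈ S, y v = algebraMap F κ (T.weight v)) :
    T.fibrePoint o q S ≤ T.ratioPoint o (fun v => y (q v)) := by
  have h := T.ratioPoint_le_of_specialization o (K := FractionRing (MvPolynomial V F))
    (aeval y : MvPolynomial V F →ₐ[F] κ) (fun v => T.partialLabel S (q v))
    (fun v => by rw [T.aeval_partialLabel hS]; exact hy _)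
  simp only [T.aeval_partialLabel hS] at h
  exact h

theorem fibrePoint_mono (T : DecoTree V Fˣ) (o : Fin n ≃ T.Edge) (q : V → V) {S S' : Set V}
    (h : S ⊆ S') : T.fibrePoint o q S ≤ T.fibrePoint o q S' :=
  T.fibrePoint_le_ratioPoint o (y := T.fibreLabel id S') (T.fibreLabel_ne_zero id S')
    fun _ hv => T.fibreLabel_of_mem (h hv)

theorem pathEquation_mem_fibrePoint_iff (T : DecoTree V Fˣ) (o : Fin n ≃ T.Edge) {q : V → V}
    (hq : ∀ v, T.IsExternal v → q v = v) {S : Set V} (hS : T.root ∈ S) {v : V}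
    (hv : T.IsExternal v) :
    T.pathEquation o v ∈ (T.fibrePoint o q S).asIdeal ↔ v ∈ S := by
  have hqr : q T.root = T.root := hq _ T.root_external
  rw [fibrePoint, T.pathEquation_mem_ratioPoint_iff o (T.fibreLabel_ne_zero q S)
    (by rw [T.fibreLabel_of_mem (by rwa [hqr]), hqr])]
  constructor
  · intro h
    by_contra hvS
    rw [fibreLabel, hq v hv, partialLabel, if_neg hvS,
      IsScalarTower.algebraMap_apply F (MvPolynomial V F) (FractionRing (MvPolynomial V F))] at h
    have h' := congrArg totalDegree (IsFractionRing.injective (MvPolynomial V F) _ h)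
    rw [totalDegree_X, algebraMap_eq, totalDegree_C] at h'
    exact one_ne_zero h'
  · intro h
    rw [T.fibreLabel_of_mem (by rwa [hq v hv]), hq v hv]

/-! ### The intersection with a face -/

/-- The relation generated by joining the ends of the edges in `E`. -/
def Joined (T : DecoTree V Fˣ) (E : Set T.Edge) : V → V → Prop :=
  Relation.EqvGen fun v w => ∃ e ∈ E, e.near = v ∧ e.far = w

theorem Joined.eq {T : DecoTree V Fˣ} {E : Set T.Edge} {v w : V} (h : T.Joined E v w)
    {α : Type*} {y : V → α} (hy : ∀ e ∈ E, y e.near = y e.far) : y v = y w := by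
  induction h with
  | rel _ _ h => obtain ⟨e, he, rfl, rfl⟩ := h; exact hy e he
  | refl _ => rfl
  | symm _ _ _ ih => exact ih.symm
  | trans _ _ _ _ _ ih ih' => exact ih.trans ih'

/-- If no two external vertices are joined by edges in `E`, the classes of joined vertices have
representatives that fix the external vertices. -/
theorem exists_representatives (T : DecoTree V Fˣ) (E : Set T.Edge)
    (hE : ∀ v w, T.IsExternal v → T.IsExternal w → T.Joined E v w → v = w) :
    ∃ q : V → V, (∀ v, T.IsExternal v → q v = v) ∧ (∀ e ∈ E, q e.near = q e.far) ∧
      ∀ v, T.Joined E v (q v) := by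
  classical
  let s : Setoid V := Relation.EqvGen.setoid fun v w => ∃ e ∈ E, e.near = v ∧ e.far = w
  let rep : Quotient s → V := fun c =>
    if h : ∃ x, T.IsExternal x ∧ Quotient.mk s x = c then h.choose else c.out
  have hrep : ∀ c, Quotient.mk s (rep c) = c := fun c => by
    by_cases h : ∃ x, T.IsExternal x ∧ Quotient.mk s x = c
    · simp only [rep, dif_pos h]
      exact h.choose_spec.2
    · simp only [rep, dif_neg h]
      exact c.out_eq
  refine ⟨fun v => rep (Quotient.mk s v), fun v hv => ?_, fun e he => ?_, fun v => ?_⟩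
  · have h : ∃ x, T.IsExternal x ∧ Quotient.mk s x = Quotient.mk s v := ⟨v, hv, rfl⟩
    simp only [rep, dif_pos h]
    exact hE _ _ h.choose_spec.1 hv (Quotient.exact h.choose_spec.2)
  · exact congrArg rep (Quotient.sound (Relation.EqvGen.rel _ _ ⟨e, he, rfl, rfl⟩))
  · exact Quotient.exact (hrep _).symm

/-- The generic point of the subvariety of a tree specializes to the point of every labelling that
extends the decoration. -/
theorem ratioPoint_label_le (T : DecoTree V Fˣ) (o : Fin n ≃ T.Edge) {κ : Type*} [Field κ]
    [Algebra F κ] {y : V → κ} (hy : ∀ v, y v ≠ 0)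
    (hext : ∀ v, T.IsExternal v → y v = algebraMap F κ (T.weight v)) :
    T.ratioPoint o T.label ≤ T.ratioPoint o y := by
  classical
  let l : V → MvPolynomial {v : V // ¬ T.IsExternal v} F := fun v =>
    if h : T.IsExternal v then C (T.weight v) else X ⟨v, h⟩
  let φ : MvPolynomial {v : V // ¬ T.IsExternal v} F →ₐ[F] κ := aeval fun v => y v
  have hl : T.label = fun v => algebraMap _ T.ParamField (l v) := funext fun v => by
    by_cases h : T.IsExternal v
    · simp only [label, l, dif_pos h, weight, ← algebraMap_eq]
      rw [← IsScalarTower.algebraMap_apply]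
    · simp only [label, l, dif_neg h]
  have hφ : ∀ v, φ (l v) = y v := fun v => by
    by_cases h : T.IsExternal v
    · simp only [φ, l, dif_pos h, aeval_C, hext v h]
    · simp only [φ, l, dif_neg h, aeval_X]
  have h := T.ratioPoint_le_of_specialization o (K := T.ParamField) φ l
    fun v => by rw [hφ]; exact hy v
  simp only [hφ] at h
  rwa [hl]

theorem mem_subvariety_iff (T : DecoTree V Fˣ) (o : Fin n ≃ T.Edge) (Q : Cube F n) :
    Q ∈ (T.subvariety o : Set (Cube F n)) ↔ T.ratioPoint o T.label ≤ Q := by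
  rw [PrimeSpectrum.le_iff_specializes, specializes_iff_mem_closure, ← T.cubePoint_edgeCoord]
  rfl

theorem pathEquation_mem_of_mem_subvariety (T : DecoTree V Fˣ) (o : Fin n ≃ T.Edge) {Q : Cube F n}
    (hQ : Q ∈ (T.subvariety o : Set (Cube F n))) {x : V} (hx : T.IsExternal x) :
    T.pathEquation o x ∈ Q.asIdeal := by
  have hl : ∀ x, T.IsExternal x → T.label x = algebraMap F _ (T.weight x) := fun x hx => by
    rw [label, weight, dif_pos hx, dif_pos hx]
  exact (T.mem_subvariety_iff o Q).mp hQ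
    ((T.pathEquation_mem_ratioPoint_iff o T.label_ne_zero (hl _ T.root_external) x).mpr (hl x hx))

theorem cubeCoord_zero : cubeCoord F (Endpoint.zero.toPoint F) = 0 := by
  change (0 : F) / (0 - 1) = 0
  simp

theorem cubeCoord_infty : cubeCoord F (Endpoint.infty.toPoint F) = 1 := rfl

/-- The points of a labelling lie on a face `{z_i = 0}` exactly if the labels at the ends of the
corresponding edges agree, and they never lie on a face with a coordinate `∞`. -/
theorem ratioPoint_mem_face_iff (T : DecoTree V Fˣ) (o : Fin n ≃ T.Edge) {κ : Type*} [Field κ]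
    [Algebra F κ] {y : V → κ} (hy : ∀ v, y v ≠ 0) (I : Finset (Fin n)) (ε : Fin n → Endpoint) :
    T.ratioPoint o y ∈ face I ε ↔
      ∀ i ∈ I, ε i = Endpoint.zero ∧ y (o i).near = y (o i).far := by
  have h : T.ratioPoint o y ∈ face I ε ↔ ∀ i ∈ I,
      (X i - C (cubeCoord F ((ε i).toPoint F)) : MvPolynomial (Fin n) F) ∈
        (T.ratioPoint o y).asIdeal := by
    rw [face, PrimeSpectrum.mem_zeroLocus]
    exact ⟨fun h i hi => h ⟨i, hi, rfl⟩, by rintro h _ ⟨i, hi, rfl⟩; exact h i hi⟩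
  rw [h]
  refine forall₂_congr fun i _ => ?_
  rw [mem_ratioPoint, map_sub, aeval_X, aeval_C]
  cases ε i with
  | zero =>
    rw [cubeCoord_zero, map_zero, sub_zero, sub_eq_zero, eq_comm, div_eq_one_iff_eq (hy _)]
    simp [eq_comm]
  | infty =>
    rw [cubeCoord_infty, map_one, sub_sub_cancel_left, neg_eq_zero, div_eq_zero_iff]
    simp [hy]

/-- A nonempty intersection of the subvariety of a generic tree with a face is the closure of the
point of the universal labelling that is constant on the vertices joined by edges of the face. -/
theorem exists_subvariety_inter_face_eq {T : DecoTree V Fˣ} (hT : T.IsGeneric)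
    (o : Fin n ≃ T.Edge) (I : Finset (Fin n)) (ε : Fin n → Endpoint)
    (hne : ((T.subvariety o : Set (Cube F n)) ∩ face I ε).Nonempty) :
    ∃ q : V → V, (∀ v, T.IsExternal v → q v = v) ∧
      (∀ S, T.fibrePoint o q S ∈ face I ε) ∧
      (∀ Q ∈ face I ε, (∀ x ∈ T.leaves, T.pathEquation o x ∈ Q.asIdeal) →
        T.fibrePoint o q T.externals ≤ Q) ∧
      (T.subvariety o : Set (Cube F n)) ∩ face I ε =
        pointClosure (T.fibrePoint o q T.externals) := by
  obtain ⟨Q₀, hQ₀, hQ₀I⟩ := hne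
  obtain ⟨y₀, hy₀, hext₀, hQy₀⟩ := T.exists_eq_ratioPoint o Q₀ fun x hx =>
    T.pathEquation_mem_of_mem_subvariety o hQ₀ hx.1
  have hI₀ := (T.ratioPoint_mem_face_iff o hy₀ I ε).mp (hQy₀ ▸ hQ₀I)
  have hE : ∀ {κ : Type _} {y : V → κ}, (∀ i ∈ I, y (o i).near = y (o i).far) →
      ∀ e ∈ (o '' I : Set T.Edge), y e.near = y e.far := by
    rintro κ y h _ ⟨i, hi, rfl⟩
    exact h i hi
  obtain ⟨q, hqext, hqE, hqJ⟩ := T.exists_representatives (o '' I) fun v w hv hw h => by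
    have h1 := h.eq (hE fun i hi => (hI₀ i hi).2)
    rw [hext₀ v hv, hext₀ w hw] at h1
    exact hT.eq_of_weight_eq hv hw ((algebraMap F _).injective h1)
  have hface : ∀ S, T.fibrePoint o q S ∈ face I ε := fun S =>
    (T.ratioPoint_mem_face_iff o (T.fibreLabel_ne_zero q S) I ε).mpr fun i hi =>
      ⟨(hI₀ i hi).1, by rw [fibreLabel, hqE (o i) ⟨i, hi, rfl⟩]; rfl⟩
  have hmin : ∀ Q ∈ face I ε, (∀ x ∈ T.leaves, T.pathEquation o x ∈ Q.asIdeal) →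
      T.fibrePoint o q T.externals ≤ Q := by
    intro Q hQI hQ
    obtain ⟨y, hy, hext, hQy⟩ := T.exists_eq_ratioPoint o Q hQ
    have hI := (T.ratioPoint_mem_face_iff o hy I ε).mp (hQy ▸ hQI)
    have hyq : (fun v => y (q v)) = y :=
      funext fun v => ((hqJ v).eq (hE fun i hi => (hI i hi).2)).symm
    have h := T.fibrePoint_le_ratioPoint o (q := q) (S := T.externals) hy hext
    rwa [hyq, ← hQy] at h
  refine ⟨q, hqext, hface, hmin, Set.ext fun Q => ?_⟩
  rw [mem_pointClosure_iff]
  constructor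
  · rintro ⟨hQ, hQI⟩
    exact hmin Q hQI fun x hx => T.pathEquation_mem_of_mem_subvariety o hQ hx.1
  · intro hQ
    constructor
    · rw [mem_subvariety_iff]
      refine le_trans ?_ hQ
      refine T.ratioPoint_label_le o (T.fibreLabel_ne_zero _ _) fun v hv => ?_
      have hqv : q v ∈ T.externals := by rwa [hqext v hv]
      rw [T.fibreLabel_of_mem hqv, hqext v hv]
    · have hcl : IsClosed (face I ε : Set (Cube F n)) := PrimeSpectrum.isClosed_zeroLocus _
      exact hcl.stableUnderSpecialization
        ((PrimeSpectrum.le_iff_specializes _ _).mp hQ) (hface _)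

/-! ### The codimension in a face -/

theorem insert_root_leaves (T : DecoTree V Fˣ) : insert T.root T.leaves = T.externals := by
  ext v
  by_cases h : v = T.root
  · subst h
    exact iff_of_true (Set.mem_insert _ _) T.root_external
  · simp [h, externals, leaves]

/-- Replacing the constants at the leaves by variables, one leaf at a time, gives a chain of
irreducible closed subsets; it is strict, because the path equation at a leaf holds exactly as long
as its label is constant. -/
theorem le_codimIn_fibrePoint (T : DecoTree V Fˣ) (o : Fin n ≃ T.Edge) {D : Set (Cube F n)}
    {q : V → V} (hq : ∀ v, T.IsExternal v → q v = v)
    (hD : ∀ S, (pointClosure (T.fibrePoint o q S) : Set (Cube F n)) ⊆ D)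
    {S : Set V} (hS : S ⊆ T.leaves) :
    S.ncard ≤ codimIn D (pointClosure (T.fibrePoint o q (insert T.root S))) (hD _) := by
  have hfin : S.Finite := Set.toFinite S
  induction S, hfin using Set.Finite.induction_on with
  | empty => simp
  | @insert x S hxS hfin ih =>
    have hx : x ∈ T.leaves := hS (Set.mem_insert x S)
    have hlt : T.fibrePoint o q (insert T.root S) <
        T.fibrePoint o q (insert T.root (insert x S)) := by
      refine lt_of_le_not_ge
        (T.fibrePoint_mono o q (Set.insert_subset_insert (Set.subset_insert x S))) fun h => ?_
      have h1 := (T.pathEquation_mem_fibrePoint_iff o hq (S := insert T.root S)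
        (Set.mem_insert _ _) hx.1).mp (h ((T.pathEquation_mem_fibrePoint_iff o hq
          (Set.mem_insert _ _) hx.1).mpr (Set.mem_insert_of_mem _ (Set.mem_insert x S))))
      exact h1.elim hx.2 hxS
    rw [Set.ncard_insert_of_notMem hxS hfin, Nat.cast_add, Nat.cast_one]
    refine (add_le_add_left (ih ((Set.subset_insert x S).trans hS)) 1).trans ?_
    exact Order.coheight_add_one_le (pointClosure_lt_pointClosure hlt)

theorem meetsInCodim_subvariety {T : DecoTree V Fˣ} (hT : T.IsGeneric) (o : Fin n ≃ T.Edge)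
    (I : Finset (Fin n)) (ε : Fin n → Endpoint) :
    MeetsInCodim T.numLeaves (T.subvariety o : Set (Cube F n)) (face I ε) := by
  intro Y hY
  obtain ⟨q, hq, hface, hmin, heq⟩ :=
    exists_subvariety_inter_face_eq hT o I ε (Y.isIrreducible.nonempty.mono hY.prop)
  have hcl : IsClosed (face I ε : Set (Cube F n)) := PrimeSpectrum.isClosed_zeroLocus _
  have hD : ∀ S, (pointClosure (T.fibrePoint o q S) : Set (Cube F n)) ⊆ face I ε := fun S =>
    hcl.closure_subset_iff.mpr (Set.singleton_subset_iff.mpr (hface S))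
  have hYP : Y = pointClosure (T.fibrePoint o q T.externals) := by
    have hYle : Y ≤ pointClosure (T.fibrePoint o q T.externals) := fun Q hQ => by
      have h := hY.prop hQ
      rwa [heq] at h
    exact le_antisymm hYle (hY.le_of_ge heq.ge hYle)
  subst hYP
  refine le_antisymm ?_ ?_
  -- The generic point is the unique minimal prime over the equations of the face and the path
  -- equations at the leaves.
  · let t : Set (MvPolynomial (Fin n) F) := T.pathEquation o '' T.leaves
    refine (codimIn_pointClosure_le (t := t) (Set.toFinite _) ⟨⟨inferInstance, ?_⟩, ?_⟩ _).trans
      (Nat.cast_le.mpr (Set.ncard_image_le (Set.toFinite _)))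
    · rw [Ideal.span_le, Set.union_subset_iff]
      refine ⟨hface T.externals, ?_⟩
      rintro _ ⟨x, hx, rfl⟩
      exact (T.pathEquation_mem_fibrePoint_iff o hq T.root_external hx.1).mpr hx.1
    · rintro Q ⟨hQ, hle⟩ -
      rw [Ideal.span_le, Set.union_subset_iff] at hle
      exact hmin ⟨Q, hQ⟩ hle.1 fun x hx => hle.2 ⟨x, hx, rfl⟩
  · have h := T.le_codimIn_fibrePoint o hq hD (subset_refl T.leaves)
    simp only [T.insert_root_leaves] at h
    exact h

theorem isAdmissible_subvariety {T : DecoTree V Fˣ} (hT : T.IsGeneric) (o : Fin n ≃ T.Edge) :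
    IsAdmissible T.numLeaves (T.subvariety o) := by
  refine ⟨?_, meetsInCodim_subvariety hT o⟩
  -- The whole cube is the face with no condition.
  have h := meetsInCodim_subvariety hT o ∅ fun _ => Endpoint.zero
  have hface : (face ∅ fun _ => Endpoint.zero : Set (Cube F n)) = Set.univ := by
    simp [face]
  rw [hface] at h
  exact h (T.subvariety o) ⟨by simp, fun W hW _ => by simpa using hW⟩

end DecoTree

end CubicalCycles

end

theorem mainTheorem3 {F : Type*} [Field F] {V : Type*} [Finite V]
    (T : CubicalCycles.DecoTree V Fˣ) (hT : T.IsGeneric) {n : ℕ} :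
    (∀ o : Fin n ≃ T.Edge, CubicalCycles.IsAdmissible T.numLeaves (T.subvariety o)) ∧
    (∀ ω : T.Orientation n, ∃ ζ : CubicalCycles.AdmissibleCycles F T.numLeaves n,
      CubicalCycles.admissibleToAll F T.numLeaves n ζ = T.forestCycling ω) := by
  refine ⟨CubicalCycles.DecoTree.isAdmissible_subvariety hT, fun ω => ?_⟩
  induction ω using Quotient.inductionOn with
  | _ o =>
    refine ⟨CubicalCycles.cycleClass
      ⟨T.subvariety o, CubicalCycles.DecoTree.isAdmissible_subvariety hT o⟩, ?_⟩
    exact FreeAbelianGroup.lift_apply_of _ _
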